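/- **Proposition (zero entropy measures).** Let $X$ be a compact metric space with metric $d$ and let $T\colon X\to X$ be continuous. Assume that $(X,T)$ is transitive, i.e. for any nonempty open $U,V\subset X$ there is $n>0$ with $T^n(U)\cap V\neq\emptyset$, and that it has the shadowing property, i.e. for every $\varepsilon>0$ there is $\delta>0$ such that for every sequence $(x_n)_{n\ge 0}$ in $X$ with $d(T(x_n),x_{n+1})<\delta$ for all $n\ge 0$ there is $y\in X$ with $d(T^n(y),x_n)<\varepsilon$ for all $n\ge 0$. Let $M_T(X)$ be the space of $T$-invariant Borel probability measures on $X$ with the weak-$*$ topology, and for $\mu\in M_T(X)$ let $h_\mu(T)\in[0,\infty]$ be the measure-theoretic (Kolmogorov–Sinai) entropy. Then the set $\{\mu\in M_T(X): h_\mu(T)=0\}$ is dense in $M_T(X)$. If, in addition, the entropy function $M_T(X)\to[0,\infty]$, $\mu\mapsto h_\mu(T)$, is upper semicontinuous, then this set is residual in $M_T(X)$, i.e. it contains a dense $G_\delta$ subset of $M_T(X)$. -/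

import Mathlib

open MeasureTheory Filter Topology
open scoped ENNReal

namespace TopDyn

/-- Topological transitivity: for any two nonempty open sets `U`, `V` there is `n > 0` with
`T^n(U) ∩ V ≠ ∅`. -/
def IsTransitive {X : Type*} [TopologicalSpace X] (T : X → X) : Prop :=
  ∀ U V : Set X, IsOpen U → IsOpen V → U.Nonempty → V.Nonempty →
    ∃ n : ℕ, 0 < n ∧ ((T^[n] '' U) ∩ V).Nonempty

/-- `x` is a `δ`-pseudo-orbit of `T`. -/
def IsPseudoOrbit {X : Type*} [MetricSpace X] (T : X → X) (δ : ℝ) (x : ℕ → X) : Prop :=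
  ∀ n : ℕ, dist (T (x n)) (x (n + 1)) < δ

/-- The sequence `x` is `ε`-traced by the point `y`. -/
def IsTracedBy {X : Type*} [MetricSpace X] (T : X → X) (ε : ℝ) (x : ℕ → X) (y : X) : Prop :=
  ∀ n : ℕ, dist (T^[n] y) (x n) < ε

/-- The shadowing property. -/
def HasShadowing {X : Type*} [MetricSpace X] (T : X → X) : Prop :=
  ∀ ε : ℝ, 0 < ε → ∃ δ : ℝ, 0 < δ ∧
    ∀ x : ℕ → X, IsPseudoOrbit T δ x → ∃ y : X, IsTracedBy T ε x y

/-- The set `M_T(X)` of `T`-invariant probability measures; as a subtype of `ProbabilityMeasure X`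
it carries the weak-* topology. -/
def invariantMeasures {X : Type*} [MeasurableSpace X] (T : X → X) :
    Set (ProbabilityMeasure X) :=
  {μ | MeasurePreserving T (μ : Measure X) (μ : Measure X)}

/-- A finite measurable partition of `X` into `k` (possibly empty) cells is given by its measurable
label function `ξ : X → Fin k`. The cells of the join of `ξ, T⁻¹ξ, …, T^{-(n-1)}ξ` are the sets of
points with a prescribed itinerary `w` of length `n`. -/
def itineraryCell {X : Type*} (T : X → X) {k : ℕ} (ξ : X → Fin k) (n : ℕ)
    (w : Fin n → Fin k) : Set X :=
  {x | ∀ i : Fin n, ξ (T^[i] x) = w i}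

/-- The Shannon entropy `H_μ(ξ ∨ T⁻¹ξ ∨ … ∨ T^{-(n-1)}ξ) = -∑ μ(A) log μ(A)`, the sum running over
the cells `A` of the join. -/
noncomputable def joinEntropy {X : Type*} [MeasurableSpace X] (T : X → X) (μ : Measure X)
    {k : ℕ} (ξ : X → Fin k) (n : ℕ) : ℝ :=
  ∑ w : Fin n → Fin k, Real.negMulLog (μ.real (itineraryCell T ξ n w))

/-- The entropy `h_μ(T, ξ) = lim (1/n) H_μ(ξ ∨ T⁻¹ξ ∨ … ∨ T^{-(n-1)}ξ)` of `T` with respect to the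
partition `ξ`. For invariant `μ` the limit exists by subadditivity, and so it is the limsup. -/
noncomputable def partitionEntropy {X : Type*} [MeasurableSpace X] (T : X → X) (μ : Measure X)
    {k : ℕ} (ξ : X → Fin k) : ℝ≥0∞ :=
  limsup (fun n : ℕ => ENNReal.ofReal (joinEntropy T μ ξ n / n)) atTop

/-- The Kolmogorov–Sinai entropy `h_μ(T) ∈ [0, ∞]`: the supremum of `h_μ(T, ξ)` over all finite
measurable partitions `ξ`. -/
noncomputable def entropy {X : Type*} [MeasurableSpace X] (T : X → X) (μ : Measure X) : ℝ≥0∞ :=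
  ⨆ (k : ℕ) (ξ : X → Fin k) (_ : Measurable ξ), partitionEntropy T μ ξ

/-- The set of invariant measures of zero entropy, as a subset of the space `M_T(X)`. -/
def zeroEntropyMeasures {X : Type*} [MeasurableSpace X] (T : X → X) :
    Set (invariantMeasures T) :=
  {μ | entropy T ((μ : ProbabilityMeasure X) : Measure X) = 0}

end TopDyn

/-! Density. Given an invariant `μ` and finitely many test functions, draw starting points
independently with law `μ`. By the law of large numbers their orbit segments of a fixed length n
reproduce the integrals, so `μ` need not be ergodic. Transitivity and compactness link the segments
by pseudo-orbits of bounded length, negligible for large n; the result closes up to a periodic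
pseudo-orbit whose averages are close to those of `μ` (`exists_periodic_pseudoOrbit_average_near`).

Shadowing need not give a periodic point, but it gives an odometer-like one. A tracing point returns
near itself at multiples of the period, and closing such a return yields a nearby periodic
pseudo-orbit with smaller error. Iterating, the limit is a true orbit which for every r is moved by
at most r under the multiples of some N (`exists_regularly_recurrent_trace`).

Limits of its empirical measures are invariant and keep this recurrence almost everywhere. Labels
then depend, up to rare errors, only on time modulo N, which forces entropy zero
(`entropy_eq_zero_of_ae_regularly_recurrent`). Under upper semicontinuity, the zero-entropy measures
are a countable intersection of open sets, and density makes them residual. -/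

namespace TopDyn

/-! ### Shannon entropy of finite-valued random variables -/

/-- The Shannon entropy of the distribution of a random variable with finitely many values. -/
noncomputable def shannonEntropy {Ω α : Type*} [MeasurableSpace Ω] [Fintype α] (μ : Measure Ω)
    (f : Ω → α) : ℝ :=
  ∑ a, Real.negMulLog (μ.real (f ⁻¹' {a}))

theorem negMulLog_sum_le {ι : Type*} (s : Finset ι) (p : ι → ℝ) (hp : ∀ i ∈ s, 0 ≤ p i) :
    Real.negMulLog (∑ i ∈ s, p i) ≤ ∑ i ∈ s, Real.negMulLog (p i) := by
  rw [Real.negMulLog, ← Finset.sum_neg_distrib, Finset.sum_mul]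
  refine Finset.sum_le_sum fun i hi => ?_
  rcases (hp i hi).eq_or_lt with h | h
  · simp [← h]
  · have : Real.log (p i) ≤ Real.log (∑ i ∈ s, p i) :=
      Real.log_le_log h (Finset.single_le_sum hp hi)
    rw [Real.negMulLog]
    nlinarith

/-- A crude substitute for the bound by log card: it is only used for a fixed number of coordinates,
whose contribution vanishes after division by n. -/
theorem shannonEntropy_le_card {Ω α : Type*} [MeasurableSpace Ω] [Fintype α] (μ : Measure Ω) [IsProbabilityMeasure μ] (f : Ω → α) :
    shannonEntropy μ f ≤ Fintype.card α := by
  unfold shannonEntropy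
  calc _ ≤ ∑ _a : α, (1 : ℝ) := Finset.sum_le_sum fun a _ =>
        (Real.negMulLog_le_one_sub_self measureReal_nonneg).trans
          (sub_le_self _ measureReal_nonneg)
    _ = _ := by simp

section Shannon

variable {Ω α β : Type*} [MeasurableSpace Ω] [Fintype α] [MeasurableSpace α]
  [MeasurableSingletonClass α] [Fintype β] [MeasurableSpace β] [MeasurableSingletonClass β]

theorem measureReal_preimage_eq_sum (μ : Measure Ω) [IsFiniteMeasure μ] {f : Ω → α}
    (hf : Measurable f) (s : Set Ω) (hs : MeasurableSet s) :
    μ.real s = ∑ a, μ.real (f ⁻¹' {a} ∩ s) := by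
  classical
  rw [← measureReal_biUnion_finset]
  · congr 1; ext x; simp
  · intro a _ b _ hab
    refine Set.disjoint_left.2 fun x hx hy => hab ?_
    exact hx.1.symm.trans hy.1
  · exact fun a _ => (hf (measurableSet_singleton a)).inter hs

theorem shannonEntropy_comp_le (μ : Measure Ω) [IsFiniteMeasure μ] {f : Ω → α}
    (hf : Measurable f) (g : α → β) :
    shannonEntropy μ (fun x => g (f x)) ≤ shannonEntropy μ f := by
  classical
  have hg : Measurable g := measurable_of_finite g
  unfold shannonEntropy
  rw [← Finset.sum_fiberwise (s := Finset.univ) (g := g)]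
  refine Finset.sum_le_sum fun b _ => ?_
  have : μ.real ((fun x => g (f x)) ⁻¹' {b}) = ∑ a with g a = b, μ.real (f ⁻¹' {a}) := by
    rw [measureReal_preimage_eq_sum μ hf ((fun x => g (f x)) ⁻¹' {b})
      ((hg.comp hf) (measurableSet_singleton b)),
      Finset.sum_filter]
    refine Finset.sum_congr rfl fun a _ => ?_
    split_ifs with h
    · congr 1; ext x; simp only [Set.mem_inter_iff, Set.mem_preimage, Set.mem_singleton_iff]
      constructor
      · exact fun hx => hx.1
      · intro hx; exact ⟨hx, by rw [hx, h]⟩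
    · rw [← measureReal_empty (μ := μ)]
      congr 1; ext x
      simp only [Set.mem_inter_iff, Set.mem_preimage, Set.mem_singleton_iff,
        Set.mem_empty_iff_false, iff_false, not_and]
      intro hx; rw [hx]; exact h
  rw [this]
  exact negMulLog_sum_le _ _ fun _ _ => measureReal_nonneg

/-- This is log t ≤ t - 1 at t = ab/p. The correction ab - p sums to zero over a joint distribution
with marginals a and b, which gives subadditivity of entropy. -/
theorem negMulLog_le_of_marginals {p a b : ℝ} (hp : 0 ≤ p) (ha : p ≤ a) (hb : p ≤ b) :
    Real.negMulLog p ≤ -p * Real.log a - p * Real.log b + (a * b - p) := by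
  rcases hp.eq_or_lt with rfl | h
  · have := mul_nonneg ha hb
    simpa using this
  · have ha' : 0 < a := h.trans_le ha
    have hb' : 0 < b := h.trans_le hb
    have key := Real.log_le_sub_one_of_pos (show 0 < a * b / p by positivity)
    rw [Real.log_div (by positivity) h.ne', Real.log_mul ha'.ne' hb'.ne'] at key
    have := mul_le_mul_of_nonneg_left key h.le
    have e : p * (a * b / p - 1) = a * b - p := by field_simp
    rw [e] at this
    rw [Real.negMulLog]
    linarith

theorem shannonEntropy_prodMk_le (μ : Measure Ω) [IsProbabilityMeasure μ] {f : Ω → α}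
    {g : Ω → β} (hf : Measurable f) (hg : Measurable g) :
    shannonEntropy μ (fun x => (f x, g x)) ≤ shannonEntropy μ f + shannonEntropy μ g := by
  have hfa := fun a => hf (measurableSet_singleton a)
  have hgb := fun b => hg (measurableSet_singleton b)
  have hpre : ∀ a b, (fun x => (f x, g x)) ⁻¹' {(a, b)} = f ⁻¹' {a} ∩ g ⁻¹' {b} := by
    intro a b; ext x; simp
  have hA : ∀ a, ∑ b, μ.real (f ⁻¹' {a} ∩ g ⁻¹' {b}) = μ.real (f ⁻¹' {a}) := by
    intro a
    rw [measureReal_preimage_eq_sum μ hg _ (hfa a)]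
    simp_rw [Set.inter_comm]
  have hB : ∀ b, ∑ a, μ.real (f ⁻¹' {a} ∩ g ⁻¹' {b}) = μ.real (g ⁻¹' {b}) := by
    intro b
    rw [measureReal_preimage_eq_sum μ hf _ (hgb b)]
  have h1 : ∑ a, μ.real (f ⁻¹' {a}) = 1 := by
    have := measureReal_preimage_eq_sum μ hf _ MeasurableSet.univ
    simpa using this.symm
  have h2 : ∑ b, μ.real (g ⁻¹' {b}) = 1 := by
    have := measureReal_preimage_eq_sum μ hg _ MeasurableSet.univ
    simpa using this.symm
  unfold shannonEntropy
  rw [Fintype.sum_prod_type]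
  simp_rw [hpre]
  calc ∑ a, ∑ b, Real.negMulLog (μ.real (f ⁻¹' {a} ∩ g ⁻¹' {b}))
      ≤ ∑ a, ∑ b, (-μ.real (f ⁻¹' {a} ∩ g ⁻¹' {b}) * Real.log (μ.real (f ⁻¹' {a}))
          - μ.real (f ⁻¹' {a} ∩ g ⁻¹' {b}) * Real.log (μ.real (g ⁻¹' {b}))
          + (μ.real (f ⁻¹' {a}) * μ.real (g ⁻¹' {b}) - μ.real (f ⁻¹' {a} ∩ g ⁻¹' {b}))) :=
        Finset.sum_le_sum fun a _ => Finset.sum_le_sum fun b _ =>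
          negMulLog_le_of_marginals measureReal_nonneg
            (measureReal_mono Set.inter_subset_left) (measureReal_mono Set.inter_subset_right)
    _ = _ := by
      simp_rw [Finset.sum_add_distrib, Finset.sum_sub_distrib]
      have e1 : ∑ a, ∑ b, -μ.real (f ⁻¹' {a} ∩ g ⁻¹' {b}) * Real.log (μ.real (f ⁻¹' {a}))
          = ∑ a, Real.negMulLog (μ.real (f ⁻¹' {a})) := by
        refine Finset.sum_congr rfl fun a _ => ?_
        rw [← Finset.sum_mul, Finset.sum_neg_distrib, hA, Real.negMulLog]
      have e2 : ∑ a, ∑ b, μ.real (f ⁻¹' {a} ∩ g ⁻¹' {b}) * Real.log (μ.real (g ⁻¹' {b}))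
          = -∑ b, Real.negMulLog (μ.real (g ⁻¹' {b})) := by
        rw [Finset.sum_comm, ← Finset.sum_neg_distrib]
        refine Finset.sum_congr rfl fun b _ => ?_
        rw [← Finset.sum_mul, hB, Real.negMulLog]; ring
      rw [e1, e2]
      simp_rw [hA, ← Finset.mul_sum, h2, mul_one, h1]
      ring

theorem shannonEntropy_pi_le (μ : Measure Ω) [IsProbabilityMeasure μ] (n : ℕ)
    (f : Fin n → Ω → α) (hf : ∀ i, Measurable (f i)) :
    shannonEntropy μ (fun x i => f i x) ≤ ∑ i, shannonEntropy μ (f i) := by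
  induction n with
  | zero =>
    simp only [shannonEntropy, Finset.univ_unique, Finset.sum_singleton, Finset.univ_eq_empty,
      Finset.sum_empty]
    have : (fun (x : Ω) (i : Fin 0) => f i x) ⁻¹' {default} = Set.univ := by
      ext x; simp [Subsingleton.elim _ (default : Fin 0 → α)]
    simp [this]
  | succ n ih =>
    have hm : Measurable (fun x (i : Fin n) => f i.succ x) :=
      measurable_pi_lambda _ fun i => hf _
    have e : (fun x i => f i x) = fun x => (fun q : α × (Fin n → α) =>
        (Fin.cons q.1 q.2 : Fin (n + 1) → α)) (f 0 x, fun i => f i.succ x) := by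
      funext x i
      refine Fin.cases ?_ (fun i => ?_) i <;> simp
    have h1 := shannonEntropy_comp_le μ ((hf 0).prodMk hm)
      (fun q : α × (Fin n → α) => (Fin.cons q.1 q.2 : Fin (n + 1) → α))
    have h2 := shannonEntropy_prodMk_le μ (hf 0) hm
    have h3 := ih (fun i => f i.succ) fun i => hf _
    rw [e, Fin.sum_univ_succ]
    linarith

/-- A random variable that is constant up to small probability has small entropy. -/
theorem exists_shannonEntropy_le (a₀ : α) {η : ℝ} (hη : 0 < η) :
    ∃ p > 0, ∀ (μ : Measure Ω) [IsProbabilityMeasure μ] (f : Ω → α), Measurable f →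
      μ.real (f ⁻¹' {a₀})ᶜ ≤ p → shannonEntropy μ f ≤ η := by
  have hc : 0 < (Fintype.card α : ℝ) := by
    have : Nonempty α := ⟨a₀⟩
    exact_mod_cast Fintype.card_pos
  set η' := η / Fintype.card α with hη'
  have hpos : 0 < η' := div_pos hη hc
  -- The function -t log t vanishes at 0 and at 1: continuity at 1 handles the value `a₀`,
  -- continuity at 0 all other values.
  obtain ⟨p, hp, hp'⟩ := Metric.continuousAt_iff.1
    (Real.continuous_negMulLog.continuousAt (x := 0)) η' hpos
  obtain ⟨q, hq, hq'⟩ := Metric.continuousAt_iff.1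
    (Real.continuous_negMulLog.continuousAt (x := 1)) η' hpos
  refine ⟨min (p / 2) (q / 2), by positivity, fun μ _ f hf hμ => ?_⟩
  have hm : μ.real (f ⁻¹' {a₀})ᶜ = 1 - μ.real (f ⁻¹' {a₀}) :=
    probReal_compl_eq_one_sub (hf (measurableSet_singleton a₀))
  have key : ∀ a, Real.negMulLog (μ.real (f ⁻¹' {a})) ≤ η' := by
    intro a
    by_cases h : a = a₀
    · subst h
      have h1 : dist (μ.real (f ⁻¹' {a})) 1 < q := by
        rw [Real.dist_eq, abs_sub_comm, ← hm, abs_of_nonneg measureReal_nonneg]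
        linarith [min_le_right (p / 2) (q / 2)]
      have := hq' h1
      rw [Real.dist_eq, Real.negMulLog_one, sub_zero] at this
      exact (le_abs_self _).trans this.le
    · have h1 : dist (μ.real (f ⁻¹' {a})) 0 < p := by
        rw [Real.dist_eq, sub_zero, abs_of_nonneg measureReal_nonneg]
        have : μ.real (f ⁻¹' {a}) ≤ μ.real (f ⁻¹' {a₀})ᶜ :=
          measureReal_mono fun x hx hx' => h (hx.symm.trans hx')
        linarith [min_le_left (p / 2) (q / 2)]
      have := hp' h1
      rw [Real.dist_eq, Real.negMulLog_zero, sub_zero] at this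
      exact (le_abs_self _).trans this.le
  calc shannonEntropy μ f ≤ ∑ _a : α, η' := Finset.sum_le_sum fun a _ => key a
    _ = η := by simp [hη']; field_simp

end Shannon

/-! ### Regular recurrence implies zero entropy -/

theorem joinEntropy_eq_shannonEntropy {X : Type*} [MeasurableSpace X] (T : X → X) (μ : Measure X)
    {k : ℕ} (ξ : X → Fin k) (n : ℕ) :
    joinEntropy T μ ξ n = shannonEntropy μ (fun x (i : Fin n) => ξ (T^[i] x)) := by
  unfold joinEntropy shannonEntropy itineraryCell
  refine Finset.sum_congr rfl fun w _ => ?_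
  congr 2
  ext x
  simp [funext_iff]

/-- A finite measurable partition is, off a set of small measure, constant on small balls. -/
theorem exists_large_set_label_locally_constant {X : Type*} [MetricSpace X] [CompactSpace X]
    [MeasurableSpace X] [BorelSpace X] (μ : Measure X) [IsFiniteMeasure μ] {k : ℕ}
    {ξ : X → Fin k} (hξ : Measurable ξ) {p : ℝ} (hp : 0 < p) :
    ∃ G : Set X, MeasurableSet G ∧ μ.real Gᶜ ≤ p ∧
      ∃ r > 0, ∀ x ∈ G, ∀ y ∈ G, dist x y ≤ r → ξ x = ξ y := by
  -- Dividing by k + 1 instead of k covers k = 0.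
  have hk : (0 : ℝ) < k + 1 := by positivity
  have hF : ∀ a : Fin k, ∃ F ⊆ ξ ⁻¹' {a}, IsClosed F ∧
      μ (ξ ⁻¹' {a} \ F) < ENNReal.ofReal (p / (k + 1)) := fun a =>
    (hξ (measurableSet_singleton a)).exists_isClosed_sdiff_lt (measure_ne_top _ _)
      (by simp only [ne_eq, ENNReal.ofReal_eq_zero, not_le]; positivity)
  choose F hFs hFc hFm using hF
  refine ⟨⋃ a, F a, .iUnion fun a => (hFc a).measurableSet, ?_, ?_⟩
  · have hsub : (⋃ a, F a)ᶜ ⊆ ⋃ a, (ξ ⁻¹' {a} \ F a) := by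
      intro x hx
      simp only [Set.mem_compl_iff, Set.mem_iUnion, not_exists] at hx
      exact Set.mem_iUnion.2 ⟨ξ x, rfl, hx _⟩
    calc μ.real (⋃ a, F a)ᶜ ≤ μ.real (⋃ a, (ξ ⁻¹' {a} \ F a)) := measureReal_mono hsub
      _ ≤ ∑ a, μ.real (ξ ⁻¹' {a} \ F a) := measureReal_iUnion_fintype_le _
      _ ≤ ∑ _a : Fin k, p / (k + 1) := Finset.sum_le_sum fun a _ =>
          ENNReal.toReal_le_of_le_ofReal (by positivity) (hFm a).le
      _ = k * (p / (k + 1)) := by simp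
      _ ≤ p := by
        rw [mul_div_assoc', div_le_iff₀ hk]
        nlinarith
  · have hpair : ∀ a b : Fin k, ∀ᶠ r in 𝓝[>] (0 : ℝ),
        ∀ x ∈ F a, ∀ y ∈ F b, dist x y ≤ r → a = b := by
      intro a b
      by_cases hab : a = b
      · exact Eventually.of_forall fun _ _ _ _ _ _ => hab
      · have hd : Disjoint (F a) (F b) := Set.disjoint_left.2 fun x hx hy =>
          hab ((hFs a hx).symm.trans (hFs b hy))
        obtain ⟨r, hr, hr'⟩ := Metric.exists_pos_forall_lt_edist (hFc a).isCompact (hFc b) hd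
        filter_upwards [Ioo_mem_nhdsGT (show (0 : ℝ) < r from hr)] with s hs x hx y hy hxy
        have h1 := hr' x hx y hy
        rw [edist_nndist, ENNReal.coe_lt_coe, ← NNReal.coe_lt_coe, coe_nndist] at h1
        linarith [hs.2]
    obtain ⟨r, hr, hr0⟩ := ((eventually_all.2 fun a => eventually_all.2 (hpair a)).and
      self_mem_nhdsWithin).exists
    refine ⟨r, hr0, fun x hx y hy hxy => ?_⟩
    obtain ⟨a, ha⟩ := Set.mem_iUnion.1 hx
    obtain ⟨b, hb⟩ := Set.mem_iUnion.1 hy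
    rw [show ξ x = a from hFs a ha, show ξ y = b from hFs b hb]
    exact hr a b x ha y hb hxy

section Recurrent

variable {X : Type*} [MeasurableSpace X] {T : X → X} {μ : Measure X} [IsProbabilityMeasure μ]

/-- If, along the multiples of `N`, the label `ξ` rarely changes, then the entropy of the joins of
`ξ` grows slowly. -/
theorem joinEntropy_le_of_almost_periodic (hT : Measurable T) {k : ℕ} {ξ : X → Fin k}
    (hξ : Measurable ξ) (a₀ : Fin k) {N : ℕ} (hN : 0 < N) {p η : ℝ}
    (hη : ∀ f : X → Bool × Fin k, Measurable f → μ.real (f ⁻¹' {(false, a₀)})ᶜ ≤ p →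
      shannonEntropy μ f ≤ η)
    (hp : ∀ i, μ.real {x | ξ (T^[i] x) ≠ ξ (T^[i % N] x)} ≤ p) (n : ℕ) :
    joinEntropy T μ ξ n ≤ N * (2 * k) + n * η := by
  classical
  have hξi : ∀ i, Measurable fun x => ξ (T^[i] x) := fun i => hξ.comp (hT.iterate i)
  -- An encoding of the itinerary: the label is spelled out (flag `true`) at times below N and
  -- wherever it differs from the label at time i mod N; otherwise a constant symbol is written.
  -- From time N on the code is constant up to probability p.
  set c : ℕ → X → Bool × Fin k := fun i x =>
    if i < N ∨ ξ (T^[i] x) ≠ ξ (T^[i % N] x) then (true, ξ (T^[i] x)) else (false, a₀) with hc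
  have hset : ∀ i, MeasurableSet {x | ξ (T^[i] x) ≠ ξ (T^[i % N] x)} := fun i =>
    (measurableSet_eq_fun (hξi i) (hξi _)).compl
  have hcm : ∀ i, Measurable (c i) := by
    intro i
    refine Measurable.ite ?_ (measurable_const.prodMk (hξi i)) measurable_const
    exact (MeasurableSet.const (i < N)).union (hset i)
  have hη0 : 0 ≤ η := by
    have := hη (fun _ => (false, a₀)) measurable_const
    refine le_trans ?_ (this (by simpa using measureReal_nonneg.trans (hp 0)))
    exact Finset.sum_nonneg fun a _ =>
      Real.negMulLog_nonneg measureReal_nonneg measureReal_le_one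
  have hcH : ∀ i, shannonEntropy μ (c i) ≤ (if i < N then (2 * k : ℝ) else 0) + η := by
    intro i
    split_ifs with hi
    · have := shannonEntropy_le_card μ (c i)
      simp only [Fintype.card_prod, Fintype.card_bool, Fintype.card_fin] at this
      push_cast at this
      linarith
    · rw [zero_add]
      refine hη _ (hcm i) ((measureReal_mono ?_).trans (hp i))
      intro x hx hx'
      refine hx ?_
      simp [hc, hi, hx']
  -- An unflagged position copies position i mod N, which is always spelled out.
  let dec : (Fin n → Bool × Fin k) → Fin n → Fin k := fun w i =>
    if (w i).1 then (w i).2 else (w ⟨i % N, (Nat.mod_le _ _).trans_lt i.2⟩).2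
  have hdec : (fun x (i : Fin n) => ξ (T^[i] x)) = fun x => dec (fun i => c i x) := by
    funext x i
    by_cases h : (i : ℕ) < N ∨ ξ (T^[i] x) ≠ ξ (T^[i % N] x)
    · simp [dec, hc, if_pos h]
    · have h' : ξ (T^[i] x) = ξ (T^[i % N] x) := by
        by_contra h'
        exact h (Or.inr h')
      have h3 : (i : ℕ) % N < N ∨ ξ (T^[i % N] x) ≠ ξ (T^[i % N % N] x) :=
        Or.inl (Nat.mod_lt _ hN)
      simp only [dec, hc, if_neg h, if_pos h3]
      simpa using h'
  rw [joinEntropy_eq_shannonEntropy, hdec]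
  have h1 := shannonEntropy_comp_le μ (f := fun x (i : Fin n) => c i x)
    (measurable_pi_lambda _ fun i => hcm i) dec
  have h2 := shannonEntropy_pi_le μ n (fun i => c i) fun i => hcm i
  have h3 : ∑ i : Fin n, shannonEntropy μ (c i)
      ≤ ∑ i : Fin n, ((if (i : ℕ) < N then (2 * k : ℝ) else 0) + η) :=
    Finset.sum_le_sum fun i _ => hcH i
  have h4 : ∑ i : Fin n, ((if (i : ℕ) < N then (2 * k : ℝ) else 0) + η) ≤ N * (2 * k) + n * η := by
    rw [Finset.sum_add_distrib,
      Fin.sum_univ_eq_sum_range (fun i => if i < N then (2 * k : ℝ) else 0) n,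
      ← Finset.sum_filter, Finset.sum_const, Finset.sum_const, Finset.card_univ, Fintype.card_fin,
      nsmul_eq_mul, nsmul_eq_mul]
    have : (Finset.range n |>.filter (· < N)).card ≤ N := by
      calc _ ≤ (Finset.range N).card := Finset.card_le_card fun i hi => by
              simp only [Finset.mem_filter] at hi
              exact Finset.mem_range.2 hi.2
        _ = N := Finset.card_range N
    gcongr
  linarith

/-- If almost every point returns uniformly close to itself along the multiples of some `N > 0`,
then the entropy vanishes. -/
theorem entropy_eq_zero_of_ae_regularly_recurrent {X : Type*} [MetricSpace X] [CompactSpace X]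
    [MeasurableSpace X] [BorelSpace X] {T : X → X} {μ : Measure X} [IsProbabilityMeasure μ]
    (hT : MeasurePreserving T μ μ)
    (h : ∀ r > 0, ∃ N > 0, ∀ᵐ x ∂μ, ∀ m, dist (T^[m * N] x) x ≤ r) :
    entropy T μ = 0 := by
  refine le_antisymm (iSup_le fun k => iSup_le fun ξ => iSup_le fun hξ => ?_) bot_le
  obtain ⟨x₀⟩ : Nonempty X := μ.nonempty_of_neZero
  refine ENNReal.le_of_forall_pos_le_add fun η hη _ => ?_
  rw [zero_add]
  have hη2 : (0 : ℝ) < η / 2 := by positivity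
  obtain ⟨p, hp, hpη⟩ := exists_shannonEntropy_le (Ω := X) (false, ξ x₀) hη2
  obtain ⟨G, hGm, hG, r, hr, hGr⟩ :=
    exists_large_set_label_locally_constant μ hξ (half_pos hp)
  obtain ⟨N, hN, hNr⟩ := h r hr
  have hfreq : ∀ i, μ.real {x | ξ (T^[i] x) ≠ ξ (T^[i % N] x)} ≤ p := by
    intro i
    have hpre : ∀ j, μ.real (T^[j] ⁻¹' Gᶜ) ≤ p / 2 := fun j => by
      rw [(hT.iterate j).measureReal_preimage hGm.compl.nullMeasurableSet]
      exact hG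
    -- The recurrence is applied at the point `T^[i % N] x`, where it holds almost surely by
    -- invariance. A label change then forces one of two points to miss G, hence the choice of p/2
    -- for G.
    have hsub : {x | ξ (T^[i] x) ≠ ξ (T^[i % N] x)} ≤ᵐ[μ]
        (T^[i] ⁻¹' Gᶜ ∪ T^[i % N] ⁻¹' Gᶜ : Set X) := by
      filter_upwards [(hT.iterate (i % N)).quasiMeasurePreserving.ae hNr] with x hx hne
      by_contra hcon
      have h1 : T^[i] x ∈ G := by_contra fun h => hcon (Or.inl h)
      have h2 : T^[i % N] x ∈ G := by_contra fun h => hcon (Or.inr h)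
      refine hne (hGr _ h1 _ h2 ?_)
      have := hx (i / N)
      rwa [← Function.iterate_add_apply, Nat.div_add_mod'] at this
    calc μ.real {x | ξ (T^[i] x) ≠ ξ (T^[i % N] x)}
        ≤ μ.real (T^[i] ⁻¹' Gᶜ ∪ T^[i % N] ⁻¹' Gᶜ) :=
          ENNReal.toReal_mono (measure_ne_top _ _) (measure_mono_ae hsub)
      _ ≤ _ := measureReal_union_le _ _
      _ ≤ p := by linarith [hpre i, hpre (i % N)]
  have hbound := joinEntropy_le_of_almost_periodic hT.measurable hξ (ξ x₀) hN
    (fun f hf => hpη μ f hf) hfreq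
  refine limsup_le_of_le (by isBoundedDefault) ?_
  have hlim : Tendsto (fun n : ℕ => (N * (2 * k) : ℝ) / n) atTop (𝓝 0) :=
    tendsto_const_div_atTop_nhds_zero_nat _
  filter_upwards [hlim.eventually_le_const hη2, eventually_gt_atTop 0] with n hn hn0
  refine ENNReal.ofReal_le_of_le_toReal ?_
  rw [ENNReal.coe_toReal]
  have hn' : (0 : ℝ) < n := by exact_mod_cast hn0
  calc joinEntropy T μ ξ n / n ≤ (N * (2 * k) + n * (η / 2)) / n := by
        gcongr; exact hbound n
    _ = N * (2 * k) / n + η / 2 := by field_simp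
    _ ≤ η := by linarith

end Recurrent

/-! ### Regularly recurrent points from shadowing -/

section Shadowing

variable {X : Type*} [MetricSpace X] [CompactSpace X] {T : X → X}

/-- A `P`-periodic pseudo-orbit that is `ε`-traced is `ε`-close to a periodic pseudo-orbit
with an arbitrarily small error. -/
theorem exists_periodic_pseudoOrbit_near {ε : ℝ} {x : ℕ → X} {P : ℕ}
    (hP : 0 < P) (hx : Function.Periodic x P) {y : X} (hy : IsTracedBy T ε x y) {δ : ℝ}
    (hδ : 0 < δ) :
    ∃ (x' : ℕ → X) (P' : ℕ), 0 < P' ∧ Function.Periodic x' P' ∧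
      IsPseudoOrbit T δ x' ∧ ∀ n, dist (x' n) (x n) < ε := by
  -- Two terms of a convergent subsequence give a near return. Both times are multiples of P, so the
  -- segment stays in phase with x and can be repeated periodically.
  obtain ⟨a, -, φ, hφ, ha⟩ := isCompact_univ.tendsto_subseq (x := fun j => T^[j * P] y)
    fun _ => Set.mem_univ _
  have hball := Metric.tendsto_atTop.1 ha (δ / 2) (half_pos hδ)
  obtain ⟨j, hj⟩ := hball
  have h1 := hj j le_rfl
  have h2 := hj (j + 1) (Nat.le_succ j)
  have hlt : φ j < φ (j + 1) := hφ (Nat.lt_succ_self j)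
  obtain ⟨k, hk⟩ := Nat.exists_eq_add_of_lt hlt
  set z := T^[φ j * P] y with hz
  have hclose : dist (T^[(k + 1) * P] z) z < δ := by
    have : T^[(k + 1) * P] z = T^[φ (j + 1) * P] y := by
      rw [hz, ← Function.iterate_add_apply, hk]
      congr 2; ring
    rw [this]
    calc _ ≤ dist (T^[φ (j + 1) * P] y) a + dist z a := dist_triangle_right _ _ _
      _ < δ := by simp only [Function.comp_apply] at h1 h2; linarith
  have hzt : ∀ n, dist (T^[n] z) (x n) < ε := by
    intro n
    have := hy (n + φ j * P)
    rwa [Function.iterate_add_apply, ← hz, ← smul_eq_mul, hx.nsmul (φ j) n] at this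
  set P' := (k + 1) * P with hP'
  have hP'0 : 0 < P' := by positivity
  refine ⟨fun n => T^[n % P'] z, P', hP'0, fun n => by simp, ?_, ?_⟩
  · intro n
    rcases (Nat.succ_le_of_lt (Nat.mod_lt n hP'0)).lt_or_eq with h | h
    · have : (n + 1) % P' = n % P' + 1 := by
        rw [Nat.add_mod, Nat.mod_eq_of_lt (a := 1), Nat.mod_eq_of_lt h]
        omega
      simp only [this, Function.iterate_succ_apply', dist_self]
      exact hδ
    · have : (n + 1) % P' = 0 := by
        rw [← Nat.mod_add_mod, ← Nat.succ_eq_add_one, h, Nat.mod_self]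
      simp only [this, Function.iterate_zero, id_eq, ← Function.iterate_succ_apply']
      rw [h]
      exact hclose
  · intro n
    have h := hzt (n % P')
    have hper : Function.Periodic x P' := hx.nsmul (k + 1)
    rwa [hper.map_mod_nat] at h

/-- In a system with shadowing, every periodic pseudo-orbit with small error is traced by a point
that returns uniformly close to itself along the multiples of some period. -/
theorem exists_regularly_recurrent_trace (hT : Continuous T) (hS : HasShadowing T) {ε : ℝ}
    (hε : 0 < ε) :
    ∃ δ > 0, ∀ (x : ℕ → X) (P : ℕ), 0 < P → Function.Periodic x P → IsPseudoOrbit T δ x →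
      ∃ z, (∀ n, dist (T^[n] z) (x n) ≤ ε) ∧
        ∀ r > 0, ∃ N > 0, ∀ n m, dist (T^[n + m * N] z) (T^[n] z) ≤ r := by
  have hεj : ∀ j : ℕ, 0 < ε / 2 / 2 ^ j := fun j => by positivity
  choose δ' hδ' hsh using fun j => hS _ (hεj j)
  -- The bound `δ' j` permits tracing at stage j; the bound 1/(j+1) makes the errors tend to zero,
  -- so that the limit is a true orbit. The tracing errors ε/2/2^j sum to ε.
  set δ : ℕ → ℝ := fun j => min (δ' j) (1 / (j + 1)) with hδdef
  have hδ : ∀ j, 0 < δ j := fun j => lt_min (hδ' j) (by positivity)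
  refine ⟨δ 0, hδ 0, fun x₀ P₀ hP₀ hx₀ hpo₀ => ?_⟩
  let S : ℕ → Type _ := fun j => {q : (ℕ → X) × ℕ //
    0 < q.2 ∧ Function.Periodic q.1 q.2 ∧ IsPseudoOrbit T (δ j) q.1}
  have hstep : ∀ j (q : S j), ∃ q' : S (j + 1), ∀ n, dist (q.1.1 n) (q'.1.1 n) ≤ ε / 2 / 2 ^ j := by
    rintro j ⟨⟨x, P⟩, hP, hx, hpo⟩
    obtain ⟨y, hy⟩ := hsh j x fun n => (hpo n).trans_le (min_le_left _ _)
    obtain ⟨x', P', hP', hx', hpo', hd⟩ :=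
      exists_periodic_pseudoOrbit_near hP hx hy (hδ (j + 1))
    exact ⟨⟨(x', P'), hP', hx', hpo'⟩, fun n => by rw [dist_comm]; exact (hd n).le⟩
  choose next hdist using hstep
  let q : ∀ j, S j := fun j => Nat.rec ⟨(x₀, P₀), hP₀, hx₀, hpo₀⟩ (fun j s => next j s) j
  have hgeo : ∀ n j, dist ((q j).1.1 n) ((q (j + 1)).1.1 n) ≤ ε / 2 / 2 ^ j :=
    fun n j => hdist j (q j) n
  choose w hw using fun n => cauchySeq_tendsto_of_complete
    (cauchySeq_of_le_geometric_two (hgeo n))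
  have hwd : ∀ n j, dist ((q j).1.1 n) (w n) ≤ ε / 2 ^ j := fun n j =>
    dist_le_of_le_geometric_two_of_tendsto (hgeo n) (hw n) j
  have horb : ∀ n, T (w n) = w (n + 1) := by
    intro n
    have hl : Tendsto (fun j => dist (T ((q j).1.1 n)) ((q j).1.1 (n + 1))) atTop
        (𝓝 (dist (T (w n)) (w (n + 1)))) :=
      ((hT.tendsto _).comp (hw n)).dist (hw (n + 1))
    have hl0 : Tendsto (fun j => dist (T ((q j).1.1 n)) ((q j).1.1 (n + 1))) atTop (𝓝 0) :=
      squeeze_zero (fun _ => dist_nonneg)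
        (fun j => ((q j).2.2.2 n).le.trans (min_le_right _ _))
        tendsto_one_div_add_atTop_nhds_zero_nat
    exact dist_eq_zero.1 (tendsto_nhds_unique hl hl0)
  have hwit : ∀ n, T^[n] (w 0) = w n := fun n => by
    induction n with
    | zero => rfl
    | succ n ih => rw [Function.iterate_succ_apply', ih, horb]
  refine ⟨w 0, fun n => ?_, fun r hr => ?_⟩
  · rw [hwit, dist_comm]
    have h0 := hwd n 0
    rw [pow_zero, div_one] at h0
    exact h0
  · have hlim : Tendsto (fun j : ℕ => 2 * (ε * (1 / 2 : ℝ) ^ j)) atTop (𝓝 0) := by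
      simpa using ((tendsto_pow_atTop_nhds_zero_of_lt_one (by norm_num : (0 : ℝ) ≤ 1 / 2)
        (by norm_num)).const_mul ε).const_mul 2
    obtain ⟨j, hj⟩ := (hlim.eventually_le_const hr).exists
    -- The orbit is within ε/2^j of the periodic sequence `q j`, uniformly in time, so shifting by a
    -- multiple of its period moves it by at most twice that.
    refine ⟨(q j).1.2, (q j).2.1, fun n m => ?_⟩
    rw [hwit, hwit]
    have h1 := hwd (n + m * (q j).1.2) j
    rw [← smul_eq_mul, (q j).2.2.1.nsmul m n, smul_eq_mul] at h1
    have h2 := hwd n j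
    have : ε / 2 ^ j = ε * (1 / 2 : ℝ) ^ j := by rw [one_div, inv_pow]; rfl
    rw [this] at h1 h2
    linarith [dist_triangle_left (w (n + m * (q j).1.2)) (w n) ((q j).1.1 n)]

end Shadowing

/-! ### Finite pseudo-orbits and their concatenation -/

/-- `PseudoPath T δ l a b` says that `l`, followed by `b`, is a finite `δ`-pseudo-orbit from `a`
to `b`. -/
inductive PseudoPath {X : Type*} [MetricSpace X] (T : X → X) (δ : ℝ) : List X → X → X → Prop
  | nil (a : X) : PseudoPath T δ [] a a
  | cons {a b c : X} {l : List X} : dist (T a) b < δ → PseudoPath T δ l b c →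
      PseudoPath T δ (a :: l) a c

theorem sum_map_iterate {X : Type*} {T : X → X} (f : X → ℝ) (n : ℕ) :
    ∀ x, ((List.iterate T x n).map f).sum = ∑ i ∈ Finset.range n, f (T^[i] x) := by
  induction n with
  | zero => simp
  | succ n ih =>
    intro x
    simp [List.iterate, Finset.sum_range_succ', ih, add_comm]

theorem sum_range_getD {X : Type*} (f : X → ℝ) (l : List X) (p : X) :
    ∑ i ∈ Finset.range l.length, f (l.getD (i % l.length) p) = (l.map f).sum := by
  have : ∀ l : List X, ∑ i ∈ Finset.range l.length, f (l.getD i p) = (l.map f).sum := by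
    intro l
    induction l with
    | nil => simp
    | cons a l ih =>
      rw [List.length_cons, Finset.sum_range_succ', List.map_cons, List.sum_cons, add_comm, ← ih]
      simp
  rw [← this]
  refine Finset.sum_congr rfl fun i hi => ?_
  rw [Nat.mod_eq_of_lt (Finset.mem_range.1 hi)]

theorem abs_sum_map_le {X : Type*} {f : X → ℝ} {M : ℝ} (hM : ∀ x, |f x| ≤ M) (l : List X) :
    |(l.map f).sum| ≤ l.length * M := by
  induction l with
  | nil => simp
  | cons a l ih =>
    rw [List.map_cons, List.sum_cons, List.length_cons]
    push_cast
    linarith [abs_add_le (f a) (l.map f).sum, hM a]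

section PseudoPath

variable {X : Type*} [MetricSpace X] {T : X → X} {δ : ℝ}

theorem PseudoPath.append {l m : List X} {a b c : X} (h : PseudoPath T δ l a b)
    (h' : PseudoPath T δ m b c) : PseudoPath T δ (l ++ m) a c := by
  induction h with
  | nil => exact h'
  | cons hd _ ih => exact .cons hd (ih h')

/-- Only the last step has an error: y replaces the point `T^[m + 1] u`. -/
theorem PseudoPath.iterate {y : X} (m : ℕ) :
    ∀ u : X, dist (T^[m + 1] u) y < δ → PseudoPath T δ (List.iterate T u (m + 1)) u y := by
  induction m with
  | zero => exact fun u h => .cons h (.nil y)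
  | succ m ih =>
    intro u h
    exact .cons (by rw [dist_self]; exact dist_nonneg.trans_lt h) (ih (T u) h)

theorem PseudoPath.getD_zero {l : List X} {a b : X} (h : PseudoPath T δ l a b) :
    l.getD 0 b = a := by
  cases h <;> simp

/-- The list omits its endpoint b; taking b as the default value of `getD` includes the final jump.
-/
theorem PseudoPath.dist_getD_lt {l : List X} {a b : X} (h : PseudoPath T δ l a b) :
    ∀ i < l.length, dist (T (l.getD i b)) (l.getD (i + 1) b) < δ := by
  induction h with
  | nil => simp
  | cons hd h ih =>
    rintro (_ | i) hi
    · rw [List.getD_cons_zero, List.getD_cons_succ, h.getD_zero]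
      exact hd
    · simpa using ih i (by simpa using hi)

/-- A closed path yields a periodic pseudo-orbit. -/
theorem PseudoPath.isPseudoOrbit {l : List X} {p : X} (h : PseudoPath T δ l p p)
    (hl : 0 < l.length) : IsPseudoOrbit T δ fun n => l.getD (n % l.length) p := by
  intro n
  have h1 := h.dist_getD_lt (n % l.length) (Nat.mod_lt _ hl)
  rcases (Nat.succ_le_of_lt (Nat.mod_lt n hl)).lt_or_eq with h2 | h2
  · have : (n + 1) % l.length = n % l.length + 1 := by
      rw [← Nat.mod_add_mod, Nat.mod_eq_of_lt h2]
    simpa only [this] using h1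
  · have h3 : (n + 1) % l.length = 0 := by
      rw [← Nat.mod_add_mod, ← Nat.succ_eq_add_one, h2, Nat.mod_self]
    have h4 : l.getD l.length p = p := by simp
    rw [← Nat.succ_eq_add_one (n % l.length), h2, h4] at h1
    simpa only [h3, h.getD_zero] using h1

/-- In a compact transitive system any two points are linked by a pseudo-orbit of uniformly bounded
length. -/
theorem IsTransitive.exists_bounded_pseudoPath [CompactSpace X] (h : IsTransitive T)
    (hδ : 0 < δ) : ∃ K : ℕ, ∀ x y, ∃ l : List X, l.length ≤ K ∧ PseudoPath T δ l x y := by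
  have hδ2 : 0 < δ / 2 := half_pos hδ
  have hab : ∀ a b : X, ∃ (m : ℕ) (u : X), u ∈ Metric.ball a (δ / 2) ∧
      T^[m + 1] u ∈ Metric.ball b (δ / 2) := by
    intro a b
    obtain ⟨n, hn, _, ⟨u, hu, rfl⟩, hv⟩ := h _ _ Metric.isOpen_ball Metric.isOpen_ball
      ⟨a, Metric.mem_ball_self hδ2⟩ ⟨b, Metric.mem_ball_self hδ2⟩
    obtain ⟨m, rfl⟩ := Nat.exists_eq_succ_of_ne_zero hn.ne'
    exact ⟨m, u, hu, hv⟩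
  choose m u hu hv using hab
  obtain ⟨t, -, htf, ht⟩ := Metric.finite_approx_of_totallyBounded
    (isCompact_univ (X := X)).totallyBounded (δ / 2) hδ2
  lift t to Finset X using htf
  -- One path is fixed per pair of net points; m + 2 counts x and the m + 1 orbit points. The net
  -- approximates `T x` rather than x, so the first jump needs no continuity of T.
  refine ⟨(t ×ˢ t).sup (fun q => m q.1 q.2 + 2), fun x y => ?_⟩
  obtain ⟨a, ha, hxa⟩ := Set.mem_iUnion₂.1 (ht (Set.mem_univ (T x)))
  obtain ⟨b, hb, hyb⟩ := Set.mem_iUnion₂.1 (ht (Set.mem_univ y))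
  refine ⟨x :: List.iterate T (u a b) (m a b + 1), ?_, .cons ?_ (PseudoPath.iterate _ _ ?_)⟩
  · rw [List.length_cons, List.length_iterate]
    exact Finset.le_sup (f := fun q : X × X => m q.1 q.2 + 2)
      (Finset.mk_mem_product (Finset.mem_coe.1 ha) (Finset.mem_coe.1 hb))
  · have := hu a b
    rw [Metric.mem_ball] at this hxa
    linarith [dist_triangle_right (T x) (u a b) a]
  · have := hv a b
    rw [Metric.mem_ball] at this hyb
    linarith [dist_triangle_right (T^[m a b + 1] (u a b)) y b]

/-- Orbit segments of a fixed length can be concatenated to a closed path through a base point. -/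
theorem exists_closed_pseudoPath {K : ℕ}
    (hK : ∀ x y, ∃ l : List X, l.length ≤ K ∧ PseudoPath T δ l x y) (hδ : 0 < δ) (p : X)
    {n : ℕ} (hn : 0 < n) (ω : ℕ → X) (L : ℕ) :
    ∃ l : List X, PseudoPath T δ l p p ∧ L * n ≤ l.length ∧ l.length ≤ L * (n + 2 * K) ∧
      ∀ (f : X → ℝ) (M : ℝ), (∀ x, |f x| ≤ M) →
        |(l.map f).sum - ∑ j ∈ Finset.range L, ∑ i ∈ Finset.range n, f (T^[i] (ω j))|
          ≤ L * (2 * K * M) := by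
  induction L with
  | zero => exact ⟨[], .nil p, by simp, by simp, by simp⟩
  | succ L ih =>
    obtain ⟨l, hl, hl1, hl2, hlf⟩ := ih
    obtain ⟨l₁, h₁, hp₁⟩ := hK p (ω L)
    obtain ⟨l₂, h₂, hp₂⟩ := hK (T^[n] (ω L)) p
    have hO : PseudoPath T δ (List.iterate T (ω L) n) (ω L) (T^[n] (ω L)) := by
      obtain ⟨m, rfl⟩ := Nat.exists_eq_succ_of_ne_zero hn.ne'
      exact PseudoPath.iterate m _ (by rwa [dist_self])
    -- Each loop runs from p to the segment and back; its two links have at most K points each,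
    -- hence the error 2KM per loop.
    refine ⟨l ++ (l₁ ++ (List.iterate T (ω L) n ++ l₂)), hl.append (hp₁.append (hO.append hp₂)),
      ?_, ?_, fun f M hM => ?_⟩
    · simp only [List.length_append, List.length_iterate]
      rw [Nat.succ_mul]; omega
    · simp only [List.length_append, List.length_iterate]
      rw [Nat.succ_mul]; omega
    · have hM0 : 0 ≤ M := (abs_nonneg _).trans (hM p)
      have e₁ := (abs_sum_map_le hM l₁).trans
        (mul_le_mul_of_nonneg_right (Nat.cast_le.2 h₁) hM0)
      have e₂ := (abs_sum_map_le hM l₂).trans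
        (mul_le_mul_of_nonneg_right (Nat.cast_le.2 h₂) hM0)
      have e := hlf f M hM
      simp only [List.map_append, List.sum_append, sum_map_iterate, Finset.sum_range_succ]
      push_cast
      rw [abs_le] at *
      constructor <;> linarith [e.1, e.2, e₁.1, e₁.2, e₂.1, e₂.2]

end PseudoPath

/-! ### Approximation by periodic pseudo-orbits -/

section Sampling

variable {X : Type*} [MeasurableSpace X]

/-- By the law of large numbers, some sequence of points samples countably many integrals. -/
theorem exists_sampling_sequence (μ : Measure X) [IsProbabilityMeasure μ] {ι : Type*} [Countable ι]
    (g : ι → X → ℝ) (hg : ∀ i, Measurable (g i)) (hgi : ∀ i, Integrable (g i) μ) :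
    ∃ ω : ℕ → X, ∀ i, Tendsto (fun L : ℕ => (∑ j ∈ Finset.range L, g i (ω j)) / L) atTop
      (𝓝 (∫ x, g i x ∂μ)) := by
  set ν := Measure.infinitePi fun _ : ℕ => μ with hν
  have hmp : ∀ j, MeasurePreserving (fun ω : ℕ → X => ω j) ν μ := fun j =>
    measurePreserving_eval_infinitePi _ j
  have key : ∀ᵐ ω ∂ν, ∀ i, Tendsto (fun L : ℕ => (∑ j ∈ Finset.range L, g i (ω j)) / L) atTop
      (𝓝 (∫ x, g i x ∂μ)) := by
    refine ae_all_iff.2 fun i => ?_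
    have hind : ProbabilityTheory.iIndepFun (fun (j : ℕ) (ω : ℕ → X) => g i (ω j)) ν :=
      ProbabilityTheory.iIndepFun_infinitePi (X := fun _ => g i) fun _ => hg i
    have := ProbabilityTheory.strong_law_ae_real (μ := ν) (fun j ω => g i (ω j))
      ((hmp 0).integrable_comp_of_integrable (hgi i)) (fun a b hab => hind.indepFun hab)
      (fun j => ?_)
    · have e : ∫ ω, g i (ω 0) ∂ν = ∫ x, g i x ∂μ := by
        rw [← (hmp 0).map_eq, integral_map (hmp 0).measurable.aemeasurable]
        exact (hg i).aestronglyMeasurable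
      rwa [e] at this
    · refine ⟨((hg i).comp (hmp j).measurable).aemeasurable,
        ((hg i).comp (hmp 0).measurable).aemeasurable, ?_⟩
      have : ∀ j, ν.map (fun ω => g i (ω j)) = μ.map (g i) := fun j => by
        rw [← (hmp j).map_eq, Measure.map_map (hg i) (hmp j).measurable]; rfl
      rw [this, this]
  exact key.exists

end Sampling

open BoundedContinuousFunction in
/-- Every invariant measure is approximated by periodic pseudo-orbits. -/
theorem exists_periodic_pseudoOrbit_average_near {X : Type*} [MetricSpace X] [CompactSpace X]
    [MeasurableSpace X] [BorelSpace X] {T : X → X} (htrans : IsTransitive T)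
    {μ : Measure X} [IsProbabilityMeasure μ] (hμ : MeasurePreserving T μ μ) (F : Finset (X →ᵇ ℝ))
    {δ η : ℝ} (hδ : 0 < δ) (hη : 0 < η) :
    ∃ (x : ℕ → X) (P : ℕ), 0 < P ∧ Function.Periodic x P ∧ IsPseudoOrbit T δ x ∧
      ∀ f ∈ F, |∑ i ∈ Finset.range P, f (x i) - P * ∫ y, f y ∂μ| ≤ P * η := by
  obtain ⟨p⟩ : Nonempty X := μ.nonempty_of_neZero
  obtain ⟨K, hK⟩ := htrans.exists_bounded_pseudoPath hδ
  set M : ℝ := ∑ f ∈ F, ‖f‖ with hM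
  have hfM : ∀ f ∈ F, ‖f‖ ≤ M := fun f hf =>
    Finset.single_le_sum (f := fun f : X →ᵇ ℝ => ‖f‖) (fun _ _ => norm_nonneg _) hf
  -- Per loop, the links cost 2KM in the sum and another 2KM because the length of the loop is not
  -- exactly n. Taking n large brings this below half of η; the other half is for sampling.
  have hlim : Tendsto (fun n : ℕ => (4 * K * M : ℝ) / n) atTop (𝓝 0) :=
    tendsto_const_div_atTop_nhds_zero_nat _
  obtain ⟨n, hn, hn0⟩ := ((hlim.eventually_le_const (half_pos hη)).and
    (eventually_gt_atTop 0)).exists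
  have hn' : (0 : ℝ) < n := by exact_mod_cast hn0
  rw [div_le_iff₀ hn'] at hn
  have hint : ∀ (f : X →ᵇ ℝ) i, Integrable (fun x => f (T^[i] x)) μ := fun f i =>
    (hμ.iterate i).integrable_comp_of_integrable (f.integrable μ)
  obtain ⟨ω, hω⟩ := exists_sampling_sequence μ
    (fun (f : F) x => ∑ i ∈ Finset.range n, f.1 (T^[i] x))
    (fun f => Finset.measurable_fun_sum _ fun i _ =>
      f.1.continuous.measurable.comp (hμ.measurable.iterate i))
    (fun f => integrable_finsetSum _ fun i _ => hint f.1 i)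
  have hmean : ∀ f : X →ᵇ ℝ, ∫ x, ∑ i ∈ Finset.range n, f (T^[i] x) ∂μ = n * ∫ x, f x ∂μ := by
    intro f
    rw [integral_finsetSum _ fun i _ => hint f i]
    have : ∀ i, ∫ x, f (T^[i] x) ∂μ = ∫ x, f x ∂μ := fun i => by
      conv_rhs => rw [← (hμ.iterate i).map_eq]
      rw [integral_map (hμ.iterate i).measurable.aemeasurable]
      exact f.continuous.measurable.aestronglyMeasurable
    simp [this]
  obtain ⟨L, hL, hL0⟩ := ((eventually_all.2 fun f : F =>
    Metric.tendsto_nhds.1 (hω f) (η / 2) (half_pos hη)).and (eventually_gt_atTop 0)).exists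
  have hL' : (0 : ℝ) < L := by exact_mod_cast hL0
  obtain ⟨l, hl, hl1, hl2, hlf⟩ := exists_closed_pseudoPath hK hδ p hn0 ω L
  have hl0 : 0 < l.length := (Nat.mul_pos hL0 hn0).trans_le hl1
  refine ⟨fun i => l.getD (i % l.length) p, l.length, hl0, fun i => by simp,
    hl.isPseudoOrbit hl0, fun f hf => ?_⟩
  rw [sum_range_getD f]
  have h1 := hlf f ‖f‖ fun x => f.norm_coe_le_norm x
  have h2 := hL ⟨f, hf⟩
  simp only [hmean] at h2
  set S := ∑ j ∈ Finset.range L, ∑ i ∈ Finset.range n, f (T^[i] (ω j)) with hS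
  set I := ∫ y, f y ∂μ with hI
  have h3 : |S - L * n * I| ≤ L * (η / 2) := by
    rw [Real.dist_eq] at h2
    have e : S - L * n * I = L * (S / L - n * I) := by field_simp
    rw [e, abs_mul, abs_of_pos hL']
    gcongr
  have hI' : |I| ≤ ‖f‖ := f.norm_integral_le_norm μ
  have hlr1 : (L * n : ℝ) ≤ l.length := by exact_mod_cast hl1
  have hlr2 : (l.length : ℝ) ≤ L * (n + 2 * K) := by exact_mod_cast hl2
  have h4 : |(L * n - l.length) * I| ≤ L * (2 * K * ‖f‖) := by
    rw [abs_mul, abs_sub_comm, abs_of_nonneg (sub_nonneg.2 hlr1)]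
    calc _ ≤ (L * (2 * K) : ℝ) * ‖f‖ := by
          gcongr
          linarith
      _ = _ := by ring
  have h5 : |(l.map f).sum - l.length * I|
      ≤ L * (2 * K * ‖f‖) + L * (η / 2) + L * (2 * K * ‖f‖) := by
    have e : (l.map f).sum - l.length * I
        = ((l.map f).sum - S) + (S - L * n * I) + (L * n - l.length) * I := by ring
    rw [e]
    exact (abs_add_three _ _ _).trans (by gcongr)
  have h6 : (L : ℝ) * (4 * K * ‖f‖) ≤ L * (η / 2 * n) := by
    refine mul_le_mul_of_nonneg_left (le_trans ?_ hn) hL'.le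
    gcongr
    exact hfM f hf
  have h7 : (L : ℝ) * (η / 2) ≤ L * n * (η / 2) := by
    have : (1 : ℝ) ≤ n := by exact_mod_cast hn0
    gcongr
    nlinarith
  nlinarith

/-! ### Empirical measures and density -/

open BoundedContinuousFunction

/-- The empirical measure of the first `n` points of the orbit of `z`. -/
noncomputable def empiricalMeasure {X : Type*} [MeasurableSpace X] (T : X → X) (z : X) (n : ℕ) :
    Measure X :=
  (n : ℝ≥0∞)⁻¹ • ∑ i ∈ Finset.range n, Measure.dirac (T^[i] z)

theorem isProbabilityMeasure_empiricalMeasure {X : Type*} [MeasurableSpace X] (T : X → X) (z : X)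
    {n : ℕ} (hn : n ≠ 0) : IsProbabilityMeasure (empiricalMeasure T z n) := by
  constructor
  simp only [empiricalMeasure, Measure.smul_apply, Measure.finsetSum_apply, measure_univ,
    Finset.sum_const, Finset.card_range, nsmul_eq_mul, mul_one, smul_eq_mul]
  exact ENNReal.inv_mul_cancel (by exact_mod_cast hn) (ENNReal.natCast_ne_top n)

theorem empiricalMeasure_eq_one {X : Type*} [MeasurableSpace X] {T : X → X} {z : X} {C : Set X} (hC : MeasurableSet C)
    (hz : ∀ i, T^[i] z ∈ C) {n : ℕ} (hn : n ≠ 0) : empiricalMeasure T z n C = 1 := by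
  have : ∀ i, Measure.dirac (T^[i] z) C = 1 := fun i => by
    rw [Measure.dirac_apply' _ hC, Set.indicator_of_mem (hz i), Pi.one_apply]
  simp only [empiricalMeasure, Measure.smul_apply, Measure.finsetSum_apply, this,
    Finset.sum_const, Finset.card_range, nsmul_eq_mul, mul_one, smul_eq_mul]
  exact ENNReal.inv_mul_cancel (by exact_mod_cast hn) (ENNReal.natCast_ne_top n)

theorem sum_range_mul_of_periodic {g : ℕ → ℝ} {P : ℕ} (hg : Function.Periodic g P) (m : ℕ) :
    ∑ i ∈ Finset.range (m * P), g i = m * ∑ i ∈ Finset.range P, g i := by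
  induction m with
  | zero => simp
  | succ m ih =>
    rw [Nat.succ_mul, Finset.sum_range_add, ih]
    have : ∀ i, g (m * P + i) = g i := fun i => by
      rw [add_comm, ← smul_eq_mul, hg.nsmul m i]
    simp only [this]
    push_cast
    ring

section Empirical

variable {X : Type*} [MetricSpace X] [CompactSpace X] [MeasurableSpace X] [BorelSpace X]
  {T : X → X}

theorem integral_empiricalMeasure (z : X) (n : ℕ) (f : X →ᵇ ℝ) :
    ∫ x, f x ∂empiricalMeasure T z n = (∑ i ∈ Finset.range n, f (T^[i] z)) / n := by
  rw [empiricalMeasure, integral_smul_measure,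
    integral_finsetSum_measure fun i _ => f.integrable _]
  simp [integral_dirac, div_eq_inv_mul]

/-- A limit of empirical measures along lengths tending to infinity is invariant. -/
theorem measurePreserving_of_tendsto_empiricalMeasure (hT : Continuous T) {z : X} {ι : Type*}
    {L : Filter ι} [L.NeBot] {n : ι → ℕ} (hn : Tendsto n L atTop) {ν : Measure X}
    [IsFiniteMeasure ν] (h : ∀ f : X →ᵇ ℝ,
      Tendsto (fun i => ∫ x, f x ∂empiricalMeasure T z (n i)) L (𝓝 (∫ x, f x ∂ν))) :
    MeasurePreserving T ν ν := by
  refine ⟨hT.measurable, ext_of_forall_integral_eq_of_IsFiniteMeasure fun f => ?_⟩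
  rw [integral_map hT.measurable.aemeasurable f.continuous.measurable.aestronglyMeasurable]
  have h1 := h (f.compContinuous ⟨T, hT⟩)
  have h2 := h f
  have h3 : Tendsto (fun i => (2 * ‖f‖) / (n i : ℝ)) L (𝓝 0) :=
    (tendsto_const_div_atTop_nhds_zero_nat _).comp hn
  have h4 : Tendsto (fun i => ∫ x, f.compContinuous ⟨T, hT⟩ x ∂empiricalMeasure T z (n i)
      - ∫ x, f x ∂empiricalMeasure T z (n i)) L (𝓝 0) := by
    refine squeeze_zero_norm (fun i => ?_) h3
    simp only [integral_empiricalMeasure, ← sub_div, norm_div, Real.norm_natCast]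
    refine div_le_div_of_nonneg_right ?_ (Nat.cast_nonneg _)
    have : ∀ k, (f.compContinuous ⟨T, hT⟩) (T^[k] z) = f (T^[k + 1] z) := fun k => by
      rw [Function.iterate_succ_apply']; rfl
    simp only [this]
    rw [← Finset.sum_sub_distrib, Finset.sum_range_sub (fun k => f (T^[k] z))]
    calc _ ≤ ‖f (T^[n i] z)‖ + ‖f (T^[0] z)‖ := norm_sub_le _ _
      _ ≤ ‖f‖ + ‖f‖ := add_le_add (f.norm_coe_le_norm _) (f.norm_coe_le_norm _)
      _ = 2 * ‖f‖ := by ring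
  exact sub_eq_zero.1 (tendsto_nhds_unique (h1.sub h2) h4)

theorem exists_zero_entropy_near (hT : Continuous T) (htrans : IsTransitive T)
    (hS : HasShadowing T) {μ : Measure X} [IsProbabilityMeasure μ] (hμ : MeasurePreserving T μ μ)
    (F : Finset (X →ᵇ ℝ)) {ε : ℝ} (hε : 0 < ε) :
    ∃ ν : ProbabilityMeasure X, MeasurePreserving T (ν : Measure X) (ν : Measure X) ∧
      entropy T (ν : Measure X) = 0 ∧
      ∀ f ∈ F, |∫ x, f x ∂(ν : Measure X) - ∫ x, f x ∂μ| ≤ ε := by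
  have hε2 := half_pos hε
  have hunif : ∀ f : X →ᵇ ℝ, ∀ᶠ ρ in 𝓝[>] (0 : ℝ), ∀ x y, dist x y ≤ ρ →
      |f x - f y| ≤ ε / 2 := by
    intro f
    obtain ⟨ρ, hρ, h⟩ := Metric.uniformContinuous_iff.1
      (CompactSpace.uniformContinuous_of_continuous f.continuous) (ε / 2) hε2
    filter_upwards [Ioo_mem_nhdsGT hρ] with s hs x y hxy
    exact (h (hxy.trans_lt hs.2)).le
  obtain ⟨ρ, hρF, hρ⟩ := (((Finset.eventually_all F).2 fun f _ => hunif f).and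
    self_mem_nhdsWithin).exists
  obtain ⟨δ, hδ, htrace⟩ := exists_regularly_recurrent_trace hT hS hρ
  obtain ⟨x, P, hP, hxP, hxδ, hxF⟩ :=
    exists_periodic_pseudoOrbit_average_near htrans hμ F hδ hε2
  obtain ⟨z, hz, hrec⟩ := htrace x P hP hxP hxδ
  have hlen : ∀ m : ℕ, (m + 1) * P ≠ 0 := fun m => (Nat.mul_pos m.succ_pos hP).ne'
  let E : ℕ → ProbabilityMeasure X := fun m =>
    ⟨empiricalMeasure T z ((m + 1) * P), isProbabilityMeasure_empiricalMeasure T z (hlen m)⟩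
  -- An ultrafilter provides a limit directly from compactness. The lengths (m + 1)P are positive
  -- multiples of P, so averages of x over them equal the average over one period.
  let U : Ultrafilter ℕ := Ultrafilter.of atTop
  have hU : (U : Filter ℕ) ≤ atTop := Ultrafilter.of_le atTop
  obtain ⟨ν, -, hν⟩ := (isCompact_univ (X := ProbabilityMeasure X)).ultrafilter_le_nhds
    (U.map E) (by simp)
  have hlim : Tendsto E U (𝓝 ν) := hν
  have hint := ProbabilityMeasure.tendsto_iff_forall_integral_tendsto.1 hlim
  have hlenlim : Tendsto (fun m : ℕ => (m + 1) * P) U atTop := by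
    refine (tendsto_atTop_mono (fun m => ?_) tendsto_id).mono_left hU
    exact (Nat.le_succ m).trans (Nat.le_mul_of_pos_right _ hP)
  have hinv : MeasurePreserving T (ν : Measure X) (ν : Measure X) :=
    measurePreserving_of_tendsto_empiricalMeasure hT hlenlim hint
  refine ⟨ν, hinv, entropy_eq_zero_of_ae_regularly_recurrent hinv fun r hr => ?_, fun f hf => ?_⟩
  · obtain ⟨N, hN, hNr⟩ := hrec r hr
    refine ⟨N, hN, ?_⟩
    -- Every empirical measure is carried by this closed set, so by the portmanteau theorem the
    -- limit is too.
    have hC : IsClosed {x | ∀ m, dist (T^[m * N] x) x ≤ r} := by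
      simp only [Set.ofPred_forall]
      exact isClosed_iInter fun m =>
        isClosed_le ((hT.iterate _).dist continuous_id) continuous_const
    have hE : ∀ m, (E m : Measure X) {x | ∀ m, dist (T^[m * N] x) x ≤ r} = 1 := fun m =>
      empiricalMeasure_eq_one hC.measurableSet (fun i k => by
        rw [← Function.iterate_add_apply, add_comm]; exact hNr i k) (hlen m)
    have := ProbabilityMeasure.limsup_measure_closed_le_of_tendsto hlim hC
    simp only [hE, limsup_const] at this
    exact (mem_ae_iff_prob_eq_one hC.measurableSet).2 (le_antisymm prob_le_one this)
  · have hclose : ∀ m, |∫ y, f y ∂(E m : Measure X) - ∫ y, f y ∂μ| ≤ ε := by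
      intro m
      have e : ∫ y, f y ∂(E m : Measure X)
          = (∑ i ∈ Finset.range ((m + 1) * P), f (T^[i] z)) / ((m + 1) * P : ℕ) :=
        integral_empiricalMeasure z _ f
      have hpos : (0 : ℝ) < ((m + 1) * P : ℕ) := by
        exact_mod_cast Nat.pos_of_ne_zero (hlen m)
      have h1 : |∑ i ∈ Finset.range ((m + 1) * P), f (T^[i] z)
          - ∑ i ∈ Finset.range ((m + 1) * P), f (x i)| ≤ ((m + 1) * P : ℕ) * (ε / 2) := by
        rw [← Finset.sum_sub_distrib]
        refine (Finset.abs_sum_le_sum_abs _ _).trans ?_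
        refine (Finset.sum_le_sum fun i _ => hρF f hf _ _ (hz i)).trans ?_
        simp
      have h2 : |∑ i ∈ Finset.range ((m + 1) * P), f (x i) - ((m + 1) * P : ℕ) * ∫ y, f y ∂μ|
          ≤ ((m + 1) * P : ℕ) * (ε / 2) := by
        rw [sum_range_mul_of_periodic (fun i => congrArg f (hxP i)) (m + 1)]
        push_cast
        rw [mul_assoc, mul_assoc, ← mul_sub, abs_mul, abs_of_pos (by positivity)]
        exact mul_le_mul_of_nonneg_left (hxF f hf) (by positivity)
      rw [e, div_sub' hpos.ne', abs_div, abs_of_pos hpos, div_le_iff₀ hpos]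
      refine (abs_sub_le _ (∑ i ∈ Finset.range ((m + 1) * P), f (x i)) _).trans ?_
      linarith
    exact le_of_tendsto ((hint f).sub_const _).abs (Eventually.of_forall hclose)

theorem dense_zeroEntropyMeasures (hT : Continuous T) (htrans : IsTransitive T)
    (hS : HasShadowing T) : Dense (zeroEntropyMeasures T) := by
  classical
  intro μ
  have hμ : MeasurePreserving T ((μ : ProbabilityMeasure X) : Measure X)
    ((μ : ProbabilityMeasure X) : Measure X) := μ.2
  have hex := fun (F : Finset (X →ᵇ ℝ)) (n : ℕ) =>
    exists_zero_entropy_near hT htrans hS hμ F (ε := 1 / ((n : ℝ) + 1)) (by positivity)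
  choose ν hinv hent hν using hex
  have hmem : ∀ F n, ν F n ∈ invariantMeasures T := hinv
  -- A net indexed by finite sets of test functions and accuracies converges to μ in the weak-*
  -- topology.
  let ν' : Finset (X →ᵇ ℝ) × ℕ → invariantMeasures T := fun q => ⟨ν q.1 q.2, hmem q.1 q.2⟩
  have hzero : ∀ q, ν' q ∈ zeroEntropyMeasures T := fun q => hent q.1 q.2
  refine mem_closure_of_tendsto (f := ν') (b := atTop) ?_ (Eventually.of_forall hzero)
  rw [tendsto_subtype_rng, ProbabilityMeasure.tendsto_iff_forall_integral_tendsto]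
  intro f
  rw [tendsto_iff_dist_tendsto_zero]
  have hlim : Tendsto (fun q : Finset (X →ᵇ ℝ) × ℕ => 1 / ((q.2 : ℝ) + 1)) atTop (𝓝 0) :=
    tendsto_one_div_add_atTop_nhds_zero_nat.comp
      (by rw [← prod_atTop_atTop_eq]; exact tendsto_snd)
  refine squeeze_zero' (Eventually.of_forall fun _ => dist_nonneg) ?_ hlim
  filter_upwards [eventually_ge_atTop (({f} : Finset (X →ᵇ ℝ)), 0)] with q hq
  rw [Real.dist_eq]
  exact hν q.1 q.2 f (hq.1 (Finset.mem_singleton_self f))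

end Empirical

end TopDyn

/-! ### Density and residuality -/

theorem mainTheorem8 {X : Type*} [MetricSpace X] [CompactSpace X] [MeasurableSpace X]
    [BorelSpace X] (T : X → X) (hT : Continuous T)
    (htrans : TopDyn.IsTransitive T) (hshadow : TopDyn.HasShadowing T) :
    Dense (TopDyn.zeroEntropyMeasures T) ∧
      (UpperSemicontinuous (fun μ : TopDyn.invariantMeasures T =>
          TopDyn.entropy T ((μ : ProbabilityMeasure X) : Measure X)) →
        TopDyn.zeroEntropyMeasures T ∈ residual (TopDyn.invariantMeasures T)) := by
  have hd := TopDyn.dense_zeroEntropyMeasures hT htrans hshadow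
  refine ⟨hd, fun husc => residual_of_dense_Gδ ?_ hd⟩
  -- Upper semicontinuity makes each strict sublevel set open, so this presents a Gδ set.
  have e : TopDyn.zeroEntropyMeasures T = ⋂ n : ℕ, (fun μ : TopDyn.invariantMeasures T =>
      TopDyn.entropy T ((μ : ProbabilityMeasure X) : Measure X)) ⁻¹'
        Set.Iio ((n + 1 : ℕ) : ℝ≥0∞)⁻¹ := by
    ext μ
    simp only [TopDyn.zeroEntropyMeasures, Set.mem_ofPred_eq, Set.mem_iInter, Set.mem_preimage,
      Set.mem_Iio]
    refine ⟨fun h n => ?_, fun h => ?_⟩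
    · rw [h]
      exact ENNReal.inv_pos.2 (ENNReal.natCast_ne_top _)
    · by_contra h0
      obtain ⟨n, hn⟩ := ENNReal.exists_inv_nat_lt h0
      refine absurd ((h n).trans_le ?_) hn.not_gt
      exact ENNReal.inv_le_inv.2 (by exact_mod_cast n.le_succ)
  rw [e]
  exact .iInter_of_isOpen fun n => husc.isOpen_preimage _
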